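/- Let $H$ be a complex Hilbert space and let $V$ be a closed isometric operator in $H$, that is, a linear operator defined on a linear subspace $D(V)\subseteq H$ with values in $H$, with closed graph and with $\|Vx\|=\|x\|$ for all $x\in D(V)$. Let $U$ be a unitary operator in a Hilbert space $\widetilde H\supseteq H$ that extends $V$, let $E(\delta)$, $\delta\in\mathfrak{B}(\mathbb{T})$, be the orthogonal (projection-valued) spectral measure of $U$ on the Borel subsets of the unit circle $\mathbb{T}$, so that $U=\int_{\mathbb{T}}\zeta\,dE(\zeta)$, and let $P_H$ be the orthogonal projection of $\widetilde H$ onto $H$. Let $$\mathbf{F}(\delta)=P_H E(\delta)|_H\quad(\delta\in\mathfrak{B}(\mathbb{T}))$$ be the spectral measure of $V$, and $$\mathbf{R}_z(V)=P_H(I-zU)^{-1}|_H\quad(|z|\neq 1)$$ the corresponding generalized resolvent of $V$, that are generated by $U$. Write $\mathbb{D}=\{z\in\mathbb{C}:|z|<1\}$ and $\mathbb{D}_e=\{z\in\mathbb{C}:|z|>1\}$. Let $\Delta$ be an open subset of $\mathbb{T}$ with $\Delta\neq\mathbb{T}$, and let $\overline{\Delta}=\{z\in\mathbb{C}:\overline{z}\in\Delta\}$.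 Then the following two conditions are equivalent: (i) $\mathbf{F}(\Delta)=0$; (ii) $\mathbf{R}_z(V)$ admits an analytic continuation to $\mathbb{D}\cup\mathbb{D}_e\cup\overline{\Delta}$, that is, there is an operator-valued function, analytic in the operator norm on the open set $\mathbb{D}\cup\mathbb{D}_e\cup\overline{\Delta}$, which equals $\mathbf{R}_z(V)$ for all $z\in\mathbb{D}\cup\mathbb{D}_e$. -/

import Mathlib

open Set
open scoped InnerProductSpace

noncomputable section

/-- The unit circle carries its Borel `σ`-algebra. -/
instance instMeasurableSpaceCircle : MeasurableSpace Circle := borel Circle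

instance instBorelSpaceCircle : BorelSpace Circle := ⟨rfl⟩

/-- An isometric operator in `H`, in general only defined on a linear subspace of `H`. -/
def LinearPMap.IsIsometric {H : Type*} [NormedAddCommGroup H] [InnerProductSpace ℂ H]
    (V : H →ₗ.[ℂ] H) : Prop :=
  ∀ x : V.domain, ‖V x‖ = ‖(x : H)‖

/-- An orthogonal (projection-valued) spectral measure on `X` acting in the Hilbert space `K`.
Only the values on measurable sets are meaningful; countable additivity is in the strong sense. -/
structure OrthogonalSpectralMeasure (X : Type*) [MeasurableSpace X]
    (K : Type*) [NormedAddCommGroup K] [InnerProductSpace ℂ K] [CompleteSpace K] where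
  /-- The operator attached to a set. -/
  proj : Set X → K →L[ℂ] K
  isStarProjection_proj : ∀ s, MeasurableSet s → IsStarProjection (proj s)
  proj_univ : proj univ = 1
  proj_inter : ∀ s t, MeasurableSet s → MeasurableSet t → proj (s ∩ t) = proj s * proj t
  hasSum_proj : ∀ f : ℕ → Set X, (∀ i, MeasurableSet (f i)) →
    Pairwise (Function.onFun Disjoint f) →
    ∀ x : K, HasSum (fun i => proj (f i) x) (proj (⋃ i, f i) x)

namespace OrthogonalSpectralMeasure

variable {X : Type*} [MeasurableSpace X]
  {K : Type*} [NormedAddCommGroup K] [InnerProductSpace ℂ K] [CompleteSpace K]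

theorem proj_empty (E : OrthogonalSpectralMeasure X K) : E.proj ∅ = 0 := by
  ext x
  have h := (E.hasSum_proj (fun _ => ∅) (fun _ => MeasurableSet.empty)
    (fun _ _ _ => disjoint_bot_left) x).summable
  simpa using (summable_const_iff (G := K) _).1 h

theorem inner_proj (E : OrthogonalSpectralMeasure X K) {s : Set X} (hs : MeasurableSet s) (x : K) :
    RCLike.re ⟪x, E.proj s x⟫_ℂ = ‖E.proj s x‖ ^ 2 := by
  have h := E.isStarProjection_proj s hs
  have h1 : E.proj s x = E.proj s (E.proj s x) := by
    conv_lhs => rw [← h.isIdempotentElem.eq]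
    rfl
  have h2 : ⟪x, E.proj s x⟫_ℂ = ⟪E.proj s x, E.proj s x⟫_ℂ := by
    conv_lhs => rw [h1]
    rw [← ContinuousLinearMap.adjoint_inner_left, ← ContinuousLinearMap.star_eq_adjoint,
      h.isSelfAdjoint.star_eq]
  rw [h2, inner_self_eq_norm_sq]

/-- The scalar measure `δ ↦ (E(δ) x, x) = ‖E(δ) x‖²`. -/
def scalarMeasure (E : OrthogonalSpectralMeasure X K) (x : K) : MeasureTheory.Measure X :=
  MeasureTheory.Measure.ofMeasurable (fun s _ => ENNReal.ofReal (‖E.proj s x‖ ^ 2))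
    (by simp [E.proj_empty])
    (by
      intro f hf hd
      have h := (E.hasSum_proj f hf hd x).mapL (innerSL ℂ x)
      have h' := h.mapL Complex.reCLM
      have h'' : HasSum (fun i => ‖E.proj (f i) x‖ ^ 2) (‖E.proj (⋃ i, f i) x‖ ^ 2) := by
        rw [← E.inner_proj (MeasurableSet.iUnion hf)]
        simp_rw [← E.inner_proj (hf _)]
        exact h'
      rw [← h''.tsum_eq, ENNReal.ofReal_tsum_of_nonneg (fun _ => sq_nonneg _) h''.summable])

theorem scalarMeasure_apply (E : OrthogonalSpectralMeasure X K) (x : K) {s : Set X}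
    (hs : MeasurableSet s) : E.scalarMeasure x s = ENNReal.ofReal (‖E.proj s x‖ ^ 2) :=
  MeasureTheory.Measure.ofMeasurable_apply s hs

/-- `E` is the orthogonal spectral measure of the unitary operator `U`: `U = ∫ ζ dE(ζ)` over the
unit circle, that is `(U x, x) = ∫ ζ d(E(ζ) x, x)` for all `x` (the operator `U` and the operators
`E(δ)` are determined by these quadratic forms). -/
def IsSpectralMeasureOf (E : OrthogonalSpectralMeasure Circle K) (U : unitary (K →L[ℂ] K)) :
    Prop :=
  ∀ x : K, ⟪x, (U : K →L[ℂ] K) x⟫_ℂ = ∫ ζ : Circle, (ζ : ℂ) ∂(E.scalarMeasure x)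

end OrthogonalSpectralMeasure

section Dilation

variable {H : Type*} [NormedAddCommGroup H] [InnerProductSpace ℂ H] [CompleteSpace H]
  {K : Type*} [NormedAddCommGroup K] [InnerProductSpace ℂ K] [CompleteSpace K]

/-- The unitary operator `U` in `K` extends `V`, where `H` is regarded as a subspace of `K`
through the isometric embedding `ι`. -/
def IsUnitaryExtension (V : H →ₗ.[ℂ] H) (ι : H →ₗᵢ[ℂ] K) (U : unitary (K →L[ℂ] K)) : Prop :=
  ∀ x : V.domain, (U : K →L[ℂ] K) (ι x) = ι (V x)

/-- The compression `P_H T|_H` to `H` of an operator `T` in `K ⊇ H`; the adjoint of the embedding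
`ι` is the orthogonal projection of `K` onto `H`. -/
def compression (ι : H →ₗᵢ[ℂ] K) (T : K →L[ℂ] K) : H →L[ℂ] H :=
  ContinuousLinearMap.adjoint ι.toContinuousLinearMap ∘L T ∘L ι.toContinuousLinearMap

/-- The spectral measure `𝐅(δ) = P_H E(δ)|_H` of an isometric operator in `H`, where `E` is the
orthogonal spectral measure of a unitary extension of it in `K ⊇ H`. -/
def spectralMeasure (ι : H →ₗᵢ[ℂ] K) (E : OrthogonalSpectralMeasure Circle K) (δ : Set Circle) :
    H →L[ℂ] H :=
  compression ι (E.proj δ)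

/-- The generalized resolvent `𝐑_z = P_H (1 - z U)⁻¹|_H`, `|z| ≠ 1`, of an isometric operator in
`H`, where `U` is a unitary extension of it in `K ⊇ H`. -/
def generalizedResolvent (ι : H →ₗᵢ[ℂ] K) (U : unitary (K →L[ℂ] K)) (z : ℂ) : H →L[ℂ] H :=
  compression ι (Ring.inverse (1 - z • (U : K →L[ℂ] K)))

end Dilation

/-- The open unit disc `𝔻`. -/
def unitDisc : Set ℂ := {z | ‖z‖ < 1}

/-- The exterior `𝔻_e` of the closed unit disc. -/
def exteriorDisc : Set ℂ := {z | 1 < ‖z‖}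

/-- The set `{z ∈ ℂ | conj z ∈ Δ}` for a subset `Δ` of the unit circle. -/
def conjSet (Δ : Set Circle) : Set ℂ := {z | ∃ ζ ∈ Δ, (starRingEnd ℂ) z = (ζ : ℂ)}

/-- The operator-valued function `R`, given on `𝔻 ∪ 𝔻_e`, has an analytic continuation (with
respect to the operator norm) to the set `S`. -/
def HasAnalyticContinuation {B : Type*} [NormedAddCommGroup B] [NormedSpace ℂ B]
    (R : ℂ → B) (S : Set ℂ) : Prop :=
  ∃ G : ℂ → B, AnalyticOnNhd ℂ G S ∧ ∀ z ∈ unitDisc ∪ exteriorDisc, G z = R z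

end

/-! Since `E(Δ)` is a projection, `(F(Δ)h, h) = ‖E(Δ)h‖²`, so (i) says that `E(Δ)` kills `H`.

(i) ⇒ (ii): on `H` the resolvent of `U` equals that of `U(1 - E(Δ))`. For `z` in `conjSet Δ`, `1 -
zU` is bounded below on `ker E(Δ)` and the truncated operator is the identity on the range of
`E(Δ)`; being normal, it is invertible (`isUnit_one_sub_smul_mul`).

(ii) ⇒ (i): with `w = 1 / conj z`, `((R_z - R_w)h, h) = (1 - |z|²)‖(1 - zU)⁻¹h‖²`. A continuation is
Lipschitz near the arc, and `|z - w|` is comparable to `1 - |z|²`, so `‖(1 - zU)⁻¹h‖` stays bounded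
as `z` tends to the circle. By `norm_proj_le` the measure `‖E(·)h‖²` of a disc of radius `δ` is then
`O(δ²)`; an arc is covered by `O(1/δ)` such discs, hence is null.

No functional calculus is used: the quadratic-form identity for `U` yields `commute` by polarisation
and the distance estimates by `norm_sub_smul_sq`. -/

open MeasureTheory

/-! ### Unitary operators and their resolvents -/

section HilbertSpace

variable {K : Type*} [NormedAddCommGroup K] [InnerProductSpace ℂ K] [CompleteSpace K]

/-- A normal operator that is bounded below is invertible. -/
theorem ContinuousLinearMap.isUnit_of_isStarNormal_of_le_norm (A : K →L[ℂ] K) [hA : IsStarNormal A]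
    {c : ℝ} (hc : 0 < c) (h : ∀ x, c * ‖x‖ ≤ ‖A x‖) : IsUnit A := by
  have hanti : AntilipschitzWith (Real.toNNReal c⁻¹) A := by
    refine AddMonoidHomClass.antilipschitz_of_bound A fun x => ?_
    rw [Real.coe_toNNReal _ (by positivity), inv_mul_eq_div, le_div_iff₀ hc, mul_comm]
    exact h x
  have hker : A.ker = ⊥ := LinearMap.ker_eq_bot.2 hanti.injective
  have hclosed : IsClosed (A.range : Set K) := by
    rw [LinearMap.coe_range]
    exact hanti.isClosed_range A.uniformContinuous
  have hrange : A.range = ⊤ := by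
    have : CompleteSpace A.range := hclosed.completeSpace_coe
    rw [← Submodule.orthogonal_eq_bot_iff, ContinuousLinearMap.IsStarNormal.orthogonal_range hA,
      hker]
  rw [ContinuousLinearMap.isUnit_iff_bijective]
  exact ⟨hanti.injective, LinearMap.range_eq_top.1 hrange⟩

namespace unitary

variable (U : unitary (K →L[ℂ] K))

theorem norm_apply (x : K) : ‖(U : K →L[ℂ] K) x‖ = ‖x‖ := by
  have h := ContinuousLinearMap.apply_norm_sq_eq_inner_adjoint_right (U : K →L[ℂ] K) x
  rw [← ContinuousLinearMap.star_eq_adjoint] at h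
  change _ = RCLike.re ⟪x, (star (U : K →L[ℂ] K) * (U : K →L[ℂ] K)) x⟫_ℂ at h
  rw [Unitary.star_mul_self_of_mem U.2] at h
  rw [one_apply_eq_self, inner_self_eq_norm_sq] at h
  exact (pow_left_inj₀ (norm_nonneg _) (norm_nonneg _) two_ne_zero).1 h

theorem abs_one_sub_norm_mul_le (z : ℂ) (x : K) :
    |1 - ‖z‖| * ‖x‖ ≤ ‖(1 - z • (U : K →L[ℂ] K)) x‖ := by
  have h := abs_norm_sub_norm_le x (z • (U : K →L[ℂ] K) x)
  rw [norm_smul, norm_apply] at h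
  calc |1 - ‖z‖| * ‖x‖ = |‖x‖ - ‖z‖ * ‖x‖| := by
        rw [← abs_of_nonneg (norm_nonneg x), ← abs_mul, abs_of_nonneg (norm_nonneg x)]; ring_nf
    _ ≤ _ := by simpa using h

theorem isStarNormal_one_sub_smul (A : K →L[ℂ] K) [IsStarNormal A] (z : ℂ) :
    IsStarNormal (1 - z • A) := by
  refine ⟨?_⟩
  have h := (star_comm_self' A)
  simp only [star_sub, star_one, star_smul, Commute, SemiconjBy, sub_mul, mul_sub, one_mul, mul_one,
    smul_mul_assoc, mul_smul_comm, h, smul_sub]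
  rw [smul_comm]
  abel

instance isStarNormal_coe : IsStarNormal (U : K →L[ℂ] K) :=
  ⟨by rw [Commute, SemiconjBy, Unitary.star_mul_self_of_mem U.2, Unitary.mul_star_self_of_mem U.2]⟩

theorem isUnit_one_sub_smul {z : ℂ} (hz : ‖z‖ ≠ 1) : IsUnit (1 - z • (U : K →L[ℂ] K)) := by
  have := isStarNormal_one_sub_smul (U : K →L[ℂ] K) z
  exact ContinuousLinearMap.isUnit_of_isStarNormal_of_le_norm _
    (abs_pos.2 (sub_ne_zero.2 hz.symm)) (abs_one_sub_norm_mul_le U z)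

theorem inverse_one_sub_smul_apply {z : ℂ} (hz : ‖z‖ ≠ 1) (x : K) :
    (1 - z • (U : K →L[ℂ] K)) (Ring.inverse (1 - z • (U : K →L[ℂ] K)) x) = x := by
  have h := Ring.mul_inverse_cancel _ (isUnit_one_sub_smul U hz)
  exact congrArg (fun T : K →L[ℂ] K => T x) h

/-- The resolvent at `z` and at the reflected point `w = 1 / conj z` differ by the Poisson kernel. -/
theorem inner_inverse_sub_inverse {z w : ℂ} (hz : ‖z‖ ≠ 1) (hw : w * (starRingEnd ℂ) z = 1)
    (x : K) :
    ⟪x, Ring.inverse (1 - z • (U : K →L[ℂ] K)) x - Ring.inverse (1 - w • (U : K →L[ℂ] K)) x⟫_ℂ =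
      (1 - ‖z‖ ^ 2 : ℝ) * ‖Ring.inverse (1 - z • (U : K →L[ℂ] K)) x‖ ^ 2 := by
  have hw1 : ‖w‖ ≠ 1 := by
    intro h
    apply hz
    simpa [h] using congrArg norm hw
  have ha := inverse_one_sub_smul_apply U hz x
  have hb := inverse_one_sub_smul_apply U hw1 x
  set a := Ring.inverse (1 - z • (U : K →L[ℂ] K)) x
  set b := Ring.inverse (1 - w • (U : K →L[ℂ] K)) x
  have hUU : ∀ y, star (U : K →L[ℂ] K) ((U : K →L[ℂ] K) y) = y := fun y =>
    congrArg (fun T : K →L[ℂ] K => T y) (Unitary.star_mul_self_of_mem U.2)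
  simp only [sub_apply, one_apply_eq_self,
    smul_apply] at ha hb
  -- Apply `conj z • U*` to `(1 - wU)(a - b) = (z - w)Ua`, using `w * conj z = 1` and `U*U = 1`.
  -- Pairing the result with `a` and moving the adjoint across gives the claim.
  have hadj : star (1 - z • (U : K →L[ℂ] K)) (a - b) = ((1 - ‖z‖ ^ 2 : ℝ) : ℂ) • a := by
    have e1 : (a - b) - w • (U : K →L[ℂ] K) (a - b) = (z - w) • (U : K →L[ℂ] K) a := by
      rw [map_sub, sub_smul, smul_sub]
      calc a - b - (w • (U : K →L[ℂ] K) a - w • (U : K →L[ℂ] K) b)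
          = a - w • (U : K →L[ℂ] K) a - (b - w • (U : K →L[ℂ] K) b) := by abel
        _ = a - w • (U : K →L[ℂ] K) a - (a - z • (U : K →L[ℂ] K) a) := by rw [hb, ha]
        _ = _ := by abel
    have e2 := congrArg (fun y => (starRingEnd ℂ) z • star (U : K →L[ℂ] K) y) e1
    simp only [map_sub, map_smul, hUU, smul_sub, smul_smul, mul_comm _ w, hw, one_smul] at e2
    simp only [star_sub, star_one, star_smul, sub_apply,
      one_apply_eq_self, smul_apply, map_sub,
      ← starRingEnd_apply]
    have hzz : (starRingEnd ℂ) z * (z - w) = ((‖z‖ ^ 2 - 1 : ℝ) : ℂ) := by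
      rw [mul_sub, mul_comm _ w, hw, ← Complex.normSq_eq_norm_sq]
      push_cast
      rw [Complex.normSq_eq_conj_mul_self]
    rw [hzz] at e2
    calc a - (starRingEnd ℂ) z • star (U : K →L[ℂ] K) a
          - (b - (starRingEnd ℂ) z • star (U : K →L[ℂ] K) b) = -(((‖z‖ ^ 2 - 1 : ℝ) : ℂ) • a) := by
            rw [← e2]; abel
      _ = _ := by rw [← neg_smul]; push_cast; ring_nf
  conv_lhs => rw [← ha]
  have : a - z • (U : K →L[ℂ] K) a = (1 - z • (U : K →L[ℂ] K)) a := by simp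
  rw [this, ← ContinuousLinearMap.adjoint_inner_right, ← ContinuousLinearMap.star_eq_adjoint, hadj,
    inner_smul_right, inner_self_eq_norm_sq_to_K]
  simp

end unitary

end HilbertSpace

/-! ### Spectral measures: commutation with `U` and distance estimates -/

namespace OrthogonalSpectralMeasure

section

variable {X : Type*} [MeasurableSpace X]
  {K : Type*} [NormedAddCommGroup K] [InnerProductSpace ℂ K] [CompleteSpace K]
  (E : OrthogonalSpectralMeasure X K)

theorem proj_comm {s t : Set X} (hs : MeasurableSet s) (ht : MeasurableSet t) (x : K) :
    E.proj s (E.proj t x) = E.proj t (E.proj s x) := by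
  have h : E.proj s * E.proj t = E.proj t * E.proj s := by
    rw [← E.proj_inter s t hs ht, inter_comm, E.proj_inter t s ht hs]
  exact congrArg (fun T : K →L[ℂ] K => T x) h

theorem proj_proj {s : Set X} (hs : MeasurableSet s) (x : K) :
    E.proj s (E.proj s x) = E.proj s x :=
  congrArg (fun T : K →L[ℂ] K => T x) (E.isStarProjection_proj s hs).isIdempotentElem.eq

theorem inner_proj_left {s : Set X} (hs : MeasurableSet s) (x y : K) :
    ⟪E.proj s x, y⟫_ℂ = ⟪x, E.proj s y⟫_ℂ := by
  rw [← ContinuousLinearMap.adjoint_inner_right, ← ContinuousLinearMap.star_eq_adjoint,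
    (E.isStarProjection_proj s hs).isSelfAdjoint.star_eq]

theorem scalarMeasure_univ (x : K) : E.scalarMeasure x univ = ENNReal.ofReal (‖x‖ ^ 2) := by
  rw [E.scalarMeasure_apply x MeasurableSet.univ, E.proj_univ, one_apply_eq_self]

instance isFiniteMeasure_scalarMeasure (x : K) : IsFiniteMeasure (E.scalarMeasure x) :=
  ⟨by rw [E.scalarMeasure_univ]; exact ENNReal.ofReal_lt_top⟩

theorem real_scalarMeasure_univ (x : K) : (E.scalarMeasure x).real univ = ‖x‖ ^ 2 := by
  rw [Measure.real, E.scalarMeasure_univ, ENNReal.toReal_ofReal (sq_nonneg _)]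

theorem scalarMeasure_eq_zero_iff (x : K) {s : Set X} (hs : MeasurableSet s) :
    E.scalarMeasure x s = 0 ↔ E.proj s x = 0 := by
  rw [E.scalarMeasure_apply x hs, ENNReal.ofReal_eq_zero]
  constructor
  · intro h
    exact norm_eq_zero.1 (pow_eq_zero_iff two_ne_zero |>.1 (le_antisymm h (sq_nonneg _)))
  · intro h
    simp [h]

/-- The projections commute, so `E(t)x` and `E(t)y` lie in the range and the kernel of `E(s)` and
Pythagoras applies. -/
theorem scalarMeasure_add {s : Set X} (hs : MeasurableSet s) {x y : K} (hx : E.proj s x = x)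
    (hy : E.proj s y = 0) :
    E.scalarMeasure (x + y) = E.scalarMeasure x + E.scalarMeasure y := by
  ext t ht
  have h0 : ⟪E.proj t x, E.proj t y⟫_ℂ = 0 := by
    rw [← hx, E.proj_comm ht hs, E.inner_proj_left hs, E.proj_comm hs ht, hy, map_zero,
      inner_zero_right]
  rw [Measure.add_apply, E.scalarMeasure_apply _ ht, E.scalarMeasure_apply _ ht,
    E.scalarMeasure_apply _ ht, ← ENNReal.ofReal_add (sq_nonneg _) (sq_nonneg _), map_add]
  simp only [sq]
  rw [norm_add_sq_eq_norm_sq_add_norm_sq_of_inner_eq_zero _ _ h0]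

end

variable {K : Type*} [NormedAddCommGroup K] [InnerProductSpace ℂ K] [CompleteSpace K]
  {E : OrthogonalSpectralMeasure Circle K} {U : unitary (K →L[ℂ] K)}

theorem integrable_of_continuous {f : Circle → ℝ} (hf : Continuous f) (x : K) :
    Integrable f (E.scalarMeasure x) :=
  hf.integrable_of_hasCompactSupport (HasCompactSupport.of_compactSpace f)

theorem integrable_of_continuous_complex {f : Circle → ℂ} (hf : Continuous f) (x : K) :
    Integrable f (E.scalarMeasure x) :=
  hf.integrable_of_hasCompactSupport (HasCompactSupport.of_compactSpace f)

namespace IsSpectralMeasureOf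

/-- Additivity of the scalar measures makes the cross terms of the form at `x + y` sum to zero;
replacing `y` by `iy` separates the two. -/
theorem inner_eq_zero (hE : E.IsSpectralMeasureOf U) {s : Set Circle} (hs : MeasurableSet s)
    {x y : K} (hx : E.proj s x = x) (hy : E.proj s y = 0) :
    ⟪x, (U : K →L[ℂ] K) y⟫_ℂ = 0 ∧ ⟪y, (U : K →L[ℂ] K) x⟫_ℂ = 0 := by
  have key : ∀ y : K, E.proj s y = 0 →
      ⟪x, (U : K →L[ℂ] K) y⟫_ℂ + ⟪y, (U : K →L[ℂ] K) x⟫_ℂ = 0 := by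
    intro y hy
    have h := hE (x + y)
    rw [E.scalarMeasure_add hs hx hy, integral_add_measure
      (integrable_of_continuous_complex (by fun_prop) x)
      (integrable_of_continuous_complex (by fun_prop) y), ← hE x, ← hE y, map_add, inner_add_left,
      inner_add_right, inner_add_right] at h
    linear_combination h
  have h1 := key y hy
  have h2 := key (Complex.I • y) (by rw [map_smul, hy, smul_zero])
  rw [map_smul, inner_smul_left, inner_smul_right, Complex.conj_I] at h2
  have h3 : ⟪x, (U : K →L[ℂ] K) y⟫_ℂ - ⟪y, (U : K →L[ℂ] K) x⟫_ℂ = 0 := by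
    apply mul_left_cancel₀ Complex.I_ne_zero
    linear_combination h2
  constructor
  · linear_combination (h1 + h3) / 2
  · linear_combination (h1 - h3) / 2

/-- By `inner_eq_zero`, `U` maps both the kernel and the range of `E(s)` into themselves. -/
theorem commute (hE : E.IsSpectralMeasureOf U) {s : Set Circle} (hs : MeasurableSet s) :
    Commute (E.proj s) (U : K →L[ℂ] K) := by
  have hc : ∀ x, E.proj s (x - E.proj s x) = 0 := fun x => by
    rw [map_sub, E.proj_proj hs, sub_self]
  have h1 : ∀ y, E.proj s y = 0 → E.proj s ((U : K →L[ℂ] K) y) = 0 := by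
    intro y hy
    refine ext_inner_left ℂ fun x => ?_
    rw [← E.inner_proj_left hs, (hE.inner_eq_zero hs (E.proj_proj hs x) hy).1, inner_zero_right]
  have h2 : ∀ x, E.proj s x = x → E.proj s ((U : K →L[ℂ] K) x) = (U : K →L[ℂ] K) x := by
    intro x hx
    refine (sub_eq_zero.1 (ext_inner_left ℂ fun y => ?_)).symm
    have := (hE.inner_eq_zero hs hx (hc y)).2
    rw [inner_sub_left, E.inner_proj_left hs] at this
    rw [inner_sub_right, this, inner_zero_right]
  ext x
  change E.proj s ((U : K →L[ℂ] K) x) = (U : K →L[ℂ] K) (E.proj s x)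
  conv_lhs => rw [← sub_add_cancel x (E.proj s x)]
  rw [map_add, map_add, h1 _ (hc x), zero_add, h2 _ (E.proj_proj hs x)]

/-- On the circle `|ζ - w|² = 2 - 2 Re(conj w * ζ)`, so only the total mass and the first moment of
the scalar measure enter. -/
theorem norm_sub_smul_sq (hE : E.IsSpectralMeasureOf U) (w : Circle) (x : K) :
    ‖(U : K →L[ℂ] K) x - (w : ℂ) • x‖ ^ 2 = ∫ ζ : Circle, dist ζ w ^ 2 ∂(E.scalarMeasure x) := by
  have hd : ∀ ζ : Circle, dist ζ w ^ 2 = 2 - 2 * (w * (starRingEnd ℂ) ζ : ℂ).re := by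
    intro ζ
    have hcoe : dist ζ w = ‖(ζ : ℂ) - w‖ := dist_eq_norm (ζ : ℂ) w
    rw [hcoe, ← Complex.normSq_eq_norm_sq, Complex.normSq_sub,
      Complex.normSq_eq_norm_sq, Complex.normSq_eq_norm_sq, Circle.norm_coe, Circle.norm_coe]
    simp only [Complex.mul_re, Complex.conj_re, Complex.conj_im]
    ring
  have hre : ∀ ζ : Circle, (w * (starRingEnd ℂ) ζ : ℂ).re = ((starRingEnd ℂ) w * (ζ : ℂ)).re := by
    intro ζ
    simp only [Complex.mul_re, Complex.conj_re, Complex.conj_im]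
    ring
  have hint : ∫ ζ : Circle, ((starRingEnd ℂ) w * (ζ : ℂ)).re ∂(E.scalarMeasure x) =
      ((starRingEnd ℂ) w * ⟪x, (U : K →L[ℂ] K) x⟫_ℂ).re := by
    rw [hE x, ← integral_const_mul]
    exact integral_re (𝕜 := ℂ) (integrable_of_continuous_complex
      (f := fun ζ : Circle => (starRingEnd ℂ) w * (ζ : ℂ)) (by fun_prop) x)
  simp_rw [hd, hre]
  rw [integral_sub (integrable_const _) (integrable_of_continuous
    (f := fun ζ : Circle => 2 * ((starRingEnd ℂ) w * (ζ : ℂ)).re) (by fun_prop) x), integral_const,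
    integral_const_mul, hint, E.real_scalarMeasure_univ, @norm_sub_sq ℂ, unitary.norm_apply,
    norm_smul, Circle.norm_coe, inner_smul_right, ← inner_conj_symm]
  simp only [RCLike.re_eq_complex_re, Complex.mul_re, Complex.conj_re, Complex.conj_im, smul_eq_mul]
  ring

/-- On the range of `E(s)`, with `s` in the disc of radius `δ` about `w`, `U` is `δ`-close to `w`. -/
theorem norm_sub_smul_le (hE : E.IsSpectralMeasureOf U) {s : Set Circle} (hs : MeasurableSet s)
    {w : Circle} {δ : ℝ} (hδ : 0 ≤ δ) (hsw : ∀ ζ ∈ s, dist ζ w ≤ δ) {x : K}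
    (hx : E.proj s x = x) : ‖(U : K →L[ℂ] K) x - (w : ℂ) • x‖ ≤ δ * ‖x‖ := by
  have h0 : E.scalarMeasure x sᶜ = 0 := by
    rw [E.scalarMeasure_eq_zero_iff x hs.compl, ← hx]
    have h := E.proj_inter sᶜ s hs.compl hs
    rw [compl_inter_self, E.proj_empty] at h
    exact (congrArg (fun T : K →L[ℂ] K => T x) h).symm
  refine le_of_sq_le_sq ?_ (by positivity)
  rw [hE.norm_sub_smul_sq]
  calc ∫ ζ : Circle, dist ζ w ^ 2 ∂(E.scalarMeasure x)
      ≤ ∫ _ : Circle, δ ^ 2 ∂(E.scalarMeasure x) := by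
        refine integral_mono_ae (integrable_of_continuous (by fun_prop) x) (integrable_const _) ?_
        have : ∀ᵐ ζ ∂(E.scalarMeasure x), ζ ∈ s := h0
        filter_upwards [this] with ζ hζ
        exact pow_le_pow_left₀ dist_nonneg (hsw ζ hζ) 2
    _ = (δ * ‖x‖) ^ 2 := by
        rw [integral_const, E.real_scalarMeasure_univ, smul_eq_mul]; ring

/-- On the kernel of `E(s)`, with `s` containing the disc of radius `δ` about `w`, `U` is at
distance `δ` from `w`. -/
theorem le_norm_sub_smul (hE : E.IsSpectralMeasureOf U) {s : Set Circle} (hs : MeasurableSet s)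
    {w : Circle} {δ : ℝ} (hδ : 0 ≤ δ) (hsw : Metric.ball w δ ⊆ s) {x : K}
    (hx : E.proj s x = 0) : δ * ‖x‖ ≤ ‖(U : K →L[ℂ] K) x - (w : ℂ) • x‖ := by
  have h0 : E.scalarMeasure x s = 0 := (E.scalarMeasure_eq_zero_iff x hs).2 hx
  refine le_of_sq_le_sq ?_ (norm_nonneg _)
  rw [hE.norm_sub_smul_sq]
  calc (δ * ‖x‖) ^ 2 = ∫ _ : Circle, δ ^ 2 ∂(E.scalarMeasure x) := by
        rw [integral_const, E.real_scalarMeasure_univ, smul_eq_mul]; ring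
    _ ≤ _ := by
        refine integral_mono_ae (integrable_const _) (integrable_of_continuous (by fun_prop) x) ?_
        have : ∀ᵐ ζ ∂(E.scalarMeasure x), ζ ∉ s := by simpa [ae_iff] using h0
        filter_upwards [this] with ζ hζ
        refine pow_le_pow_left₀ hδ ?_ 2
        by_contra hlt
        exact hζ (hsw (Metric.mem_ball.2 (not_le.1 hlt)))

end IsSpectralMeasureOf

end OrthogonalSpectralMeasure

/-! ### Null arcs on the circle -/

section Dilation

theorem Circle.dist_exp_le (s t : ℝ) : dist (Circle.exp s) (Circle.exp t) ≤ |s - t| := by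
  have hcoe : dist (Circle.exp s) (Circle.exp t) =
      ‖(Circle.exp s : ℂ) - (Circle.exp t : ℂ)‖ := dist_eq_norm (Circle.exp s : ℂ) (Circle.exp t : ℂ)
  have h : (Circle.exp s : ℂ) - (Circle.exp t : ℂ) =
      (Circle.exp t : ℂ) * (Complex.exp (Complex.I * (s - t : ℝ)) - 1) := by
    rw [Circle.coe_exp, Circle.coe_exp, mul_sub, ← Complex.exp_add, mul_one]
    congr 2
    push_cast
    ring
  rw [hcoe, h, norm_mul, Circle.norm_coe, one_mul]
  exact Real.norm_exp_I_mul_ofReal_sub_one_le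

/-- An arc is null for a measure whose values on discs of radius `δ` centred at it are `O(δ²)`. -/
theorem MeasureTheory.Measure.image_circleExp_Ioo_eq_zero (μ : Measure Circle) [IsFiniteMeasure μ]
    {a L C δ₀ : ℝ} (hL : 0 < L) (hδ₀ : 0 < δ₀)
    (h : ∀ t ∈ Icc a (a + L), ∀ δ ∈ Ioc 0 δ₀,
      μ.real (Metric.closedBall (Circle.exp t) δ) ≤ C * δ ^ 2) :
    μ (Circle.exp '' Ioo a (a + L)) = 0 := by
  -- Since `Circle.exp` is 1-Lipschitz, `n` discs of radius `L / n` centred at the left ends of the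
  -- cells cover the arc, for a total of `n * C(L / n)²`.
  have hbound : ∀ n : ℕ, 0 < n → L / n ≤ δ₀ →
      μ.real (Circle.exp '' Ioo a (a + L)) ≤ C * L ^ 2 / n := by
    intro n hn hnδ
    have hn' : (0 : ℝ) < n := Nat.cast_pos.2 hn
    have hsub : Circle.exp '' Ioo a (a + L) ⊆ ⋃ j ∈ Finset.range n,
        Metric.closedBall (Circle.exp (a + j * (L / n))) (L / n) := by
      rintro _ ⟨t, ht, rfl⟩
      have hpos : 0 ≤ (t - a) / (L / n) := div_nonneg (by linarith [ht.1]) (by positivity)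
      have h1 := Nat.floor_le hpos
      have h2 := Nat.lt_floor_add_one ((t - a) / (L / n))
      rw [le_div_iff₀ (by positivity)] at h1
      rw [div_lt_iff₀ (by positivity), add_mul, one_mul] at h2
      refine mem_iUnion₂.2 ⟨⌊(t - a) / (L / n)⌋₊, Finset.mem_range.2 ?_, ?_⟩
      · rw [Nat.floor_lt hpos, div_lt_iff₀ (by positivity), mul_div_cancel₀ _ hn'.ne']
        linarith [ht.2]
      · refine Metric.mem_closedBall.2 ((Circle.dist_exp_le _ _).trans (abs_le.2 ⟨?_, ?_⟩)) <;>
          linarith [div_pos hL hn']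
    calc μ.real (Circle.exp '' Ioo a (a + L)) ≤ μ.real (⋃ j ∈ Finset.range n,
          Metric.closedBall (Circle.exp (a + j * (L / n))) (L / n)) :=
          measureReal_mono hsub (measure_ne_top _ _)
      _ ≤ ∑ j ∈ Finset.range n, μ.real
          (Metric.closedBall (Circle.exp (a + j * (L / n))) (L / n)) :=
          measureReal_biUnion_finset_le _ _
      _ ≤ ∑ _j ∈ Finset.range n, C * (L / n) ^ 2 := by
          refine Finset.sum_le_sum fun j hj => h _ ⟨?_, ?_⟩ _ ⟨by positivity, hnδ⟩
          · have : 0 ≤ (j : ℝ) * (L / n) := by positivity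
            linarith
          · have hj' : (j : ℝ) ≤ n := Nat.cast_le.2 (Finset.mem_range.1 hj).le
            have := mul_le_mul_of_nonneg_right hj' (div_pos hL hn').le
            rw [mul_div_cancel₀ _ hn'.ne'] at this
            linarith
      _ = C * L ^ 2 / n := by
          rw [Finset.sum_const, Finset.card_range, nsmul_eq_mul]
          field_simp
  have hlim : Filter.Tendsto (fun n : ℕ => C * L ^ 2 / (n : ℝ)) Filter.atTop (nhds 0) :=
    tendsto_const_div_atTop_nhds_zero_nat _
  have hδ : ∀ᶠ n : ℕ in Filter.atTop, L / n ≤ δ₀ :=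
    (tendsto_const_div_atTop_nhds_zero_nat L).eventually (ge_mem_nhds hδ₀)
  have hle : μ.real (Circle.exp '' Ioo a (a + L)) ≤ 0 := by
    refine ge_of_tendsto hlim ?_
    filter_upwards [hδ, Filter.eventually_gt_atTop 0] with n h1 h2 using hbound n h2 h1
  exact (measureReal_eq_zero_iff).1 (le_antisymm hle measureReal_nonneg)

/-! ### Compressions to `H` -/

variable {H : Type*} [NormedAddCommGroup H] [InnerProductSpace ℂ H] [CompleteSpace H]
  {K : Type*} [NormedAddCommGroup K] [InnerProductSpace ℂ K] [CompleteSpace K]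

theorem compression_apply (ι : H →ₗᵢ[ℂ] K) (T : K →L[ℂ] K) (h : H) :
    compression ι T h = ContinuousLinearMap.adjoint ι.toContinuousLinearMap (T (ι h)) := rfl

theorem inner_compression (ι : H →ₗᵢ[ℂ] K) (T : K →L[ℂ] K) (h : H) :
    ⟪h, compression ι T h⟫_ℂ = ⟪ι h, T (ι h)⟫_ℂ := by
  rw [compression_apply, ContinuousLinearMap.adjoint_inner_right]
  rfl

theorem spectralMeasure_eq_zero_iff (ι : H →ₗᵢ[ℂ] K) (E : OrthogonalSpectralMeasure Circle K)
    {s : Set Circle} (hs : MeasurableSet s) :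
    spectralMeasure ι E s = 0 ↔ ∀ h, E.proj s (ι h) = 0 := by
  constructor
  · intro h0 h
    have h1 := inner_compression ι (E.proj s) h
    rw [show compression ι (E.proj s) = 0 from h0, zero_apply, inner_zero_right] at h1
    have h2 := E.inner_proj hs (ι h)
    rw [← h1, map_zero] at h2
    exact norm_eq_zero.1 (pow_eq_zero_iff two_ne_zero |>.1 h2.symm)
  · intro h0
    ext h
    change compression ι (E.proj s) h = 0
    rw [compression_apply, h0 h, map_zero]

theorem analyticAt_compression_inverse (ι : H →ₗᵢ[ℂ] K) (T : K →L[ℂ] K) {z : ℂ}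
    (hz : IsUnit (1 - z • T)) :
    AnalyticAt ℂ (fun z : ℂ => compression ι (Ring.inverse (1 - z • T))) z := by
  have h1 : AnalyticAt ℂ (fun z : ℂ => 1 - z • T) z := by fun_prop
  have h2 : AnalyticAt ℂ (Ring.inverse : (K →L[ℂ] K) → K →L[ℂ] K) (1 - z • T) := by
    have := analyticAt_inverse (𝕜 := ℂ) hz.unit
    rwa [hz.unit_spec] at this
  have h3 := AnalyticAt.fun_comp (f := fun z : ℂ => 1 - z • T) h2 h1
  let A : (K →L[ℂ] K) →L[ℂ] (H →L[ℂ] H) :=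
    (ContinuousLinearMap.compL ℂ H K H (ContinuousLinearMap.adjoint ι.toContinuousLinearMap)).comp
      ((ContinuousLinearMap.compL ℂ H K K).flip ι.toContinuousLinearMap)
  exact (A.analyticAt _).comp h3

/-! ### The truncated operator and the two implications -/

namespace OrthogonalSpectralMeasure.IsSpectralMeasureOf

variable {E : OrthogonalSpectralMeasure Circle K} {U : unitary (K →L[ℂ] K)}

/-- Cutting `U` off a spectral set `s` makes `1 - z U` invertible as soon as it is bounded below on
the complement of `s`. -/
theorem isUnit_one_sub_smul_mul (hE : E.IsSpectralMeasureOf U) {s : Set Circle}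
    (hs : MeasurableSet s) {z : ℂ} {c : ℝ} (hc : 0 < c)
    (h : ∀ x, E.proj s x = 0 → c * ‖x‖ ≤ ‖(1 - z • (U : K →L[ℂ] K)) x‖) :
    IsUnit (1 - z • ((U : K →L[ℂ] K) * (1 - E.proj s))) := by
  have hcomm : Commute (U : K →L[ℂ] K) (1 - E.proj s) :=
    (Commute.one_right _).sub_right (hE.commute hs).symm
  have hQ : IsStarProjection (1 - E.proj s) := (E.isStarProjection_proj s hs).one_sub
  have hnormal : IsStarNormal ((U : K →L[ℂ] K) * (1 - E.proj s)) := by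
    have hcomm' : Commute (star (U : K →L[ℂ] K)) (1 - E.proj s) := by
      have := hcomm.star_star
      rwa [hQ.isSelfAdjoint.star_eq] at this
    refine ⟨?_⟩
    rw [star_mul, hQ.isSelfAdjoint.star_eq]
    exact (hcomm.symm.mul_right (Commute.refl _)).mul_left
      ((isStarNormal_iff _ |>.1 (unitary.isStarNormal_coe U)).mul_right hcomm')
  have := unitary.isStarNormal_one_sub_smul ((U : K →L[ℂ] K) * (1 - E.proj s)) z
  -- The operator is bounded below by `c` on `ker E(s)` and is the identity on the range of `E(s)`;
  -- both are invariant and orthogonal, whence `min c 1`.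
  refine ContinuousLinearMap.isUnit_of_isStarNormal_of_le_norm _ (lt_min hc one_pos) fun x => ?_
  set p := E.proj s x with hp
  have hpp : E.proj s p = p := E.proj_proj hs x
  have hq : E.proj s (x - p) = 0 := by rw [map_sub, hpp, sub_self]
  have hUq : E.proj s ((1 - z • (U : K →L[ℂ] K)) (x - p)) = 0 := by
    have hcU : Commute (E.proj s) (1 - z • (U : K →L[ℂ] K)) :=
      (Commute.one_right _).sub_right ((hE.commute hs).smul_right z)
    have := congrArg (fun T : K →L[ℂ] K => T (x - p)) hcU.eq
    refine this.trans ?_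
    change (1 - z • (U : K →L[ℂ] K)) (E.proj s (x - p)) = 0
    rw [hq, map_zero]
  have horth : ∀ y, E.proj s y = 0 → ‖y + p‖ * ‖y + p‖ = ‖y‖ * ‖y‖ + ‖p‖ * ‖p‖ := by
    intro y hy
    refine norm_add_sq_eq_norm_sq_add_norm_sq_of_inner_eq_zero (𝕜 := ℂ) _ _ ?_
    rw [← hpp, ← E.inner_proj_left hs, hy, inner_zero_left]
  have hdecomp : (1 - z • ((U : K →L[ℂ] K) * (1 - E.proj s))) x =
      (1 - z • (U : K →L[ℂ] K)) (x - p) + p := by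
    change x - z • (U : K →L[ℂ] K) (x - p) = x - p - z • (U : K →L[ℂ] K) (x - p) + p
    abel
  have h1 := horth _ hUq
  have h2 := horth _ hq
  rw [sub_add_cancel] at h2
  rw [hdecomp]
  have hm0 : 0 ≤ min c 1 := (lt_min hc one_pos).le
  have h3 : min c 1 * ‖x - p‖ ≤ ‖(1 - z • (U : K →L[ℂ] K)) (x - p)‖ :=
    (mul_le_mul_of_nonneg_right (min_le_left _ _) (norm_nonneg _)).trans (h _ hq)
  have h4 : min c 1 * ‖p‖ ≤ ‖p‖ :=
    mul_le_of_le_one_left (norm_nonneg _) (min_le_right _ _)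
  refine le_of_sq_le_sq ?_ (norm_nonneg _)
  have h5 := mul_self_le_mul_self (mul_nonneg hm0 (norm_nonneg _)) h3
  have h6 := mul_self_le_mul_self (mul_nonneg hm0 (norm_nonneg _)) h4
  calc (min c 1 * ‖x‖) ^ 2 = min c 1 * min c 1 * (‖x‖ * ‖x‖) := by ring
    _ ≤ _ := by rw [h2, sq, h1]; linarith

theorem inverse_one_sub_smul_mul_apply (hE : E.IsSpectralMeasureOf U) {s : Set Circle}
    (hs : MeasurableSet s) {z : ℂ} (hz : ‖z‖ ≠ 1)
    (hunit : IsUnit (1 - z • ((U : K →L[ℂ] K) * (1 - E.proj s)))) {x : K}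
    (hx : E.proj s x = 0) :
    Ring.inverse (1 - z • ((U : K →L[ℂ] K) * (1 - E.proj s))) x =
      Ring.inverse (1 - z • (U : K →L[ℂ] K)) x := by
  set R := Ring.inverse (1 - z • (U : K →L[ℂ] K))
  have hR : Commute (E.proj s) R := by
    obtain ⟨u, hu⟩ := unitary.isUnit_one_sub_smul U hz
    have hcU : Commute (E.proj s) u :=
      hu ▸ (Commute.one_right _).sub_right ((hE.commute hs).smul_right z)
    have hRu : R = ↑u⁻¹ := by rw [← Ring.inverse_unit u, hu]
    exact hRu ▸ hcU.units_inv_right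
  have h1 : E.proj s (R x) = 0 := by
    have := congrArg (fun T : K →L[ℂ] K => T x) hR.eq
    change E.proj s (R x) = R (E.proj s x) at this
    rw [this, hx, map_zero]
  have h2 : (1 - z • ((U : K →L[ℂ] K) * (1 - E.proj s))) (R x) = x := by
    change R x - z • (U : K →L[ℂ] K) (R x - E.proj s (R x)) = x
    rw [h1, sub_zero]
    exact unitary.inverse_one_sub_smul_apply U hz x
  have h3 := congrArg (fun T : K →L[ℂ] K => T (R x)) (Ring.inverse_mul_cancel _ hunit)
  refine (congrArg (Ring.inverse _ : K →L[ℂ] K) h2).symm.trans h3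

/-- For `z = (1 - δ) conj w` one has `zw = 1 - δ`, so `1 - zU = δ - z(U - w)`, of norm at most `2δ`
on the range of `E(s)`. Apply this to `y = E(s)(1 - zU)⁻¹x`, for which `(1 - zU)y = E(s)x`. -/
theorem norm_proj_le (hE : E.IsSpectralMeasureOf U) {w : Circle} {δ : ℝ} (hδ : 0 < δ)
    (hδ1 : δ ≤ 1 / 2) (x : K) :
    ‖E.proj (Metric.closedBall w δ) x‖ ≤ 2 * δ *
      ‖Ring.inverse (1 - ((1 - δ : ℝ) * (starRingEnd ℂ) w : ℂ) • (U : K →L[ℂ] K)) x‖ := by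
  set z : ℂ := (1 - δ : ℝ) * (starRingEnd ℂ) w with hzdef
  have hznorm : ‖z‖ = 1 - δ := by
    rw [hzdef, norm_mul, RCLike.norm_conj, Circle.norm_coe, mul_one, Complex.norm_real,
      Real.norm_of_nonneg (by linarith)]
  have hz : ‖z‖ ≠ 1 := by rw [hznorm]; linarith
  have hs : MeasurableSet (Metric.closedBall w δ) := Metric.isClosed_closedBall.measurableSet
  set s := Metric.closedBall w δ
  set R := Ring.inverse (1 - z • (U : K →L[ℂ] K))
  have hR := unitary.inverse_one_sub_smul_apply U hz x
  have hcU : Commute (E.proj s) (1 - z • (U : K →L[ℂ] K)) :=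
    (Commute.one_right _).sub_right ((hE.commute hs).smul_right z)
  set y := E.proj s (R x) with hy
  have hyy : E.proj s y = y := E.proj_proj hs _
  have h1 : E.proj s x = (1 - z • (U : K →L[ℂ] K)) y := by
    conv_lhs => rw [← hR]
    exact congrArg (fun T : K →L[ℂ] K => T (R x)) hcU.eq
  have h2 : (1 - z • (U : K →L[ℂ] K)) y =
      (δ : ℂ) • y - z • ((U : K →L[ℂ] K) y - (w : ℂ) • y) := by
    change y - z • (U : K →L[ℂ] K) y = _
    have hzw : z * (w : ℂ) = 1 - δ := by
      rw [hzdef, mul_assoc, ← Complex.normSq_eq_conj_mul_self, Circle.normSq_coe]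
      push_cast
      ring
    rw [smul_sub, smul_smul, hzw, sub_smul, one_smul]
    abel
  have h3 : ‖y‖ ≤ ‖R x‖ := by
    have hb := E.isStarProjection_proj s hs |>.norm_le
    exact (E.proj s).le_of_opNorm_le hb (R x) |>.trans_eq (one_mul _)
  have h4 := hE.norm_sub_smul_le hs hδ.le (fun ζ hζ => Metric.mem_closedBall.1 hζ) hyy
  rw [h1, h2]
  calc _ ≤ ‖(δ : ℂ) • y‖ + ‖z • ((U : K →L[ℂ] K) y - (w : ℂ) • y)‖ := norm_sub_le _ _
    _ ≤ δ * ‖y‖ + 1 * (δ * ‖y‖) := by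
        rw [norm_smul, norm_smul, Complex.norm_real, Real.norm_of_nonneg hδ.le]
        gcongr
        linarith
    _ = 2 * δ * ‖y‖ := by ring
    _ ≤ _ := by gcongr

theorem hasAnalyticContinuation (hE : E.IsSpectralMeasureOf U) (ι : H →ₗᵢ[ℂ] K)
    {Δ : Set Circle} (hΔ : IsOpen Δ) (h0 : spectralMeasure ι E Δ = 0) :
    HasAnalyticContinuation (generalizedResolvent ι U)
      (unitDisc ∪ exteriorDisc ∪ conjSet Δ) := by
  have hs := hΔ.measurableSet
  rw [spectralMeasure_eq_zero_iff ι E hs] at h0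
  have hunit : ∀ z : ℂ, ‖z‖ ≠ 1 → IsUnit (1 - z • ((U : K →L[ℂ] K) * (1 - E.proj Δ))) :=
    fun z hz => hE.isUnit_one_sub_smul_mul hs (abs_pos.2 (sub_ne_zero.2 hz.symm))
      fun x _ => unitary.abs_one_sub_norm_mul_le U z x
  have hne : ∀ z ∈ unitDisc ∪ exteriorDisc, ‖z‖ ≠ 1 := by
    rintro z (hz | hz)
    · exact ne_of_lt hz
    · exact ne_of_gt hz
  refine ⟨fun z => compression ι (Ring.inverse (1 - z • ((U : K →L[ℂ] K) * (1 - E.proj Δ)))),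
    fun z hz => analyticAt_compression_inverse ι _ ?_, fun z hz => ?_⟩
  · rcases hz with hz | ⟨ζ, hζ, hzζ⟩
    · exact hunit z (hne z hz)
    · obtain ⟨δ, hδ, hball⟩ := Metric.isOpen_iff.1 hΔ ζ hζ
      -- As `zζ = 1`, `1 - zU = -z(U - ζ)`, and `ζ` is at distance at least `δ` from the complement
      -- of `Δ`.
      refine hE.isUnit_one_sub_smul_mul hs hδ fun x hx => ?_
      have hznorm : ‖z‖ = 1 := by rw [← RCLike.norm_conj, hzζ, Circle.norm_coe]
      have hz1 : z * (ζ : ℂ) = 1 := by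
        rw [← hzζ, Complex.mul_conj, Complex.normSq_eq_norm_sq, hznorm]; simp
      have heq : (1 - z • (U : K →L[ℂ] K)) x = -(z • ((U : K →L[ℂ] K) x - (ζ : ℂ) • x)) := by
        change x - z • (U : K →L[ℂ] K) x = _
        rw [smul_sub, smul_smul, hz1, one_smul, neg_sub]
      rw [heq, norm_neg, norm_smul, hznorm, one_mul]
      exact hE.le_norm_sub_smul hs hδ.le hball hx
  · ext h
    change compression ι _ h = compression ι _ h
    rw [compression_apply, compression_apply,
      hE.inverse_one_sub_smul_mul_apply hs (hne z hz) (hunit z (hne z hz)) (h0 h)]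

theorem spectralMeasure_eq_zero (hE : E.IsSpectralMeasureOf U) (ι : H →ₗᵢ[ℂ] K)
    {Δ : Set Circle} (hΔ : IsOpen Δ) (hG : HasAnalyticContinuation (generalizedResolvent ι U)
      (unitDisc ∪ exteriorDisc ∪ conjSet Δ)) : spectralMeasure ι E Δ = 0 := by
  obtain ⟨G, hGan, hGeq⟩ := hG
  rw [spectralMeasure_eq_zero_iff ι E hΔ.measurableSet]
  intro h
  rw [← E.scalarMeasure_eq_zero_iff _ hΔ.measurableSet]
  refine measure_null_of_locally_null _ fun ζ₀ hζ₀ => ?_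
  obtain ⟨t₀, rfl⟩ : ∃ t, Circle.exp t = ζ₀ := ⟨_, Circle.exp_arg ζ₀⟩
  set z₀ : ℂ := (starRingEnd ℂ) (Circle.exp t₀ : ℂ) with hz₀
  have hmem : z₀ ∈ unitDisc ∪ exteriorDisc ∪ conjSet Δ :=
    Or.inr ⟨_, hζ₀, Complex.conj_conj _⟩
  obtain ⟨C, S, hS, hLip⟩ := ((hGan z₀ hmem).contDiffAt (n := 1)).exists_lipschitzOnWith
  -- For `p = (t, δ)` these two maps give `z = (1 - δ) conj ζ` and its reflection `w = 1 / conj z`;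
  -- both must stay in the set `S` where `G` is `C`-Lipschitz.
  have hcont1 : ContinuousAt (fun p : ℝ × ℝ =>
      ((1 - p.2 : ℝ) : ℂ) * (starRingEnd ℂ) (Circle.exp p.1 : ℂ)) (t₀, 0) := by
    fun_prop
  have hcont2 : ContinuousAt (fun p : ℝ × ℝ =>
      (((1 - p.2)⁻¹ : ℝ) : ℂ) * (starRingEnd ℂ) (Circle.exp p.1 : ℂ)) (t₀, 0) := by
    have : ContinuousAt (fun p : ℝ × ℝ => (1 - p.2)⁻¹) (t₀, 0) :=
      ContinuousAt.inv₀ (by fun_prop) (by norm_num)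
    exact (Complex.continuous_ofReal.continuousAt.comp this).mul (by fun_prop)
  have hev := (hcont1.preimage_mem_nhds (t := S) (by
    rw [sub_zero, Complex.ofReal_one, one_mul]; exact hS))
  have hev' := (hcont2.preimage_mem_nhds (t := S) (by
    rw [sub_zero, inv_one, Complex.ofReal_one, one_mul]; exact hS))
  obtain ⟨η, hη, hball⟩ := Metric.mem_nhds_iff.1 (Filter.inter_mem hev hev')
  refine ⟨Circle.exp '' Ioo (t₀ - η / 2) (t₀ - η / 2 + η), mem_nhdsWithin_of_mem_nhds
    ((isLocalHomeomorph_circleExp.isOpenMap _ isOpen_Ioo).mem_nhds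
      ⟨t₀, ⟨by linarith, by linarith⟩, rfl⟩), ?_⟩
  -- The factor 8 is `2²` from `norm_proj_le` times the 2 in `ρ² ≤ 2C‖h‖²`.
  refine Measure.image_circleExp_Ioo_eq_zero (C := 8 * C * ‖h‖ ^ 2) (δ₀ := min (η / 2) (1 / 2)) _
    hη (lt_min (by linarith) (by norm_num)) fun t ht δ hδ => ?_
  have hδη : δ ≤ η / 2 := hδ.2.trans (min_le_left _ _)
  have hδ1 : δ ≤ 1 / 2 := hδ.2.trans (min_le_right _ _)
  have hδ0 : 0 < δ := hδ.1
  have hpos : 0 < 1 - δ := by linarith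
  have hp : (t, δ) ∈ Metric.ball (t₀, (0 : ℝ)) η := by
    rw [Metric.mem_ball, Prod.dist_eq, max_lt_iff, Real.dist_eq, Real.dist_eq]
    exact ⟨abs_lt.2 ⟨by linarith [ht.1], by linarith [ht.2]⟩,
      abs_lt.2 ⟨by linarith, by linarith⟩⟩
  obtain ⟨hzS, hwS⟩ := hball hp
  simp only [mem_preimage] at hzS hwS
  have hproj := hE.norm_proj_le (w := Circle.exp t) hδ0 hδ1 (ι h)
  set c : ℂ := (starRingEnd ℂ) (Circle.exp t : ℂ) with hc
  have hcnorm : ‖c‖ = 1 := by rw [hc, RCLike.norm_conj, Circle.norm_coe]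
  have hnorm : ∀ r : ℝ, 0 < r → ‖(r : ℂ) * c‖ = r := fun r hr => by
    rw [norm_mul, hcnorm, mul_one, Complex.norm_real, Real.norm_of_nonneg hr.le]
  set z : ℂ := ((1 - δ : ℝ) : ℂ) * c
  set w : ℂ := (((1 - δ)⁻¹ : ℝ) : ℂ) * c
  have hz : ‖z‖ = 1 - δ := hnorm _ hpos
  have hw : ‖w‖ = (1 - δ)⁻¹ := hnorm _ (inv_pos.2 hpos)
  have hinv : 1 < (1 - δ)⁻¹ := (one_lt_inv₀ hpos).2 (by linarith)
  have hwz : w * (starRingEnd ℂ) z = 1 := by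
    have hcc : c * (starRingEnd ℂ) c = 1 := by
      rw [Complex.mul_conj, Complex.normSq_eq_norm_sq, hcnorm]; simp
    have hrr : (((1 - δ)⁻¹ : ℝ) : ℂ) * ((1 - δ : ℝ) : ℂ) = 1 := by
      rw [← Complex.ofReal_mul, inv_mul_cancel₀ hpos.ne', Complex.ofReal_one]
    rw [map_mul, Complex.conj_ofReal, mul_mul_mul_comm, hcc, hrr, one_mul]
  have hdist : dist z w = (1 - δ)⁻¹ - (1 - δ) := by
    rw [dist_comm, dist_eq_norm, ← sub_mul, ← Complex.ofReal_sub, hnorm _ (by linarith)]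
  have hpoisson := unitary.inner_inverse_sub_inverse U (z := z) (by rw [hz]; linarith) hwz (ι h)
  set ρ := ‖Ring.inverse (1 - z • (U : K →L[ℂ] K)) (ι h)‖
  have hGz : G z = generalizedResolvent ι U z :=
    hGeq z (Or.inl (show ‖z‖ < 1 by rw [hz]; linarith))
  have hGw : G w = generalizedResolvent ι U w :=
    hGeq w (Or.inr (show 1 < ‖w‖ by rw [hw]; exact hinv))
  have hinner : ⟪h, (G z - G w) h⟫_ℂ = (1 - ‖z‖ ^ 2 : ℝ) * ρ ^ 2 := by
    rw [← hpoisson, hGz, hGw, sub_apply, inner_sub_right, inner_sub_right]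
    congr 1 <;> exact inner_compression ι _ h
  have hsq : 0 < 1 - (1 - δ) ^ 2 := by nlinarith
  have hle : (1 - (1 - δ) ^ 2) * ρ ^ 2 ≤ C * ((1 - δ)⁻¹ - (1 - δ)) * ‖h‖ ^ 2 := by
    calc (1 - (1 - δ) ^ 2) * ρ ^ 2 = ‖⟪h, (G z - G w) h⟫_ℂ‖ := by
          rw [hinner, hz, ← Complex.ofReal_pow, ← Complex.ofReal_mul, Complex.norm_real,
            Real.norm_of_nonneg (by positivity)]
      _ ≤ ‖h‖ * (‖G z - G w‖ * ‖h‖) := (norm_inner_le_norm _ _).trans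
          (mul_le_mul_of_nonneg_left ((G z - G w).le_opNorm h) (norm_nonneg _))
      _ ≤ ‖h‖ * (C * ((1 - δ)⁻¹ - (1 - δ)) * ‖h‖) := by
          gcongr
          rw [← hdist, ← dist_eq_norm]
          exact hLip.dist_le_mul z hzS w hwS
      _ = _ := by ring
  -- The distance `|z - w| = (1 - |z|²) / |z|` cancels the Poisson factor `1 - |z|²`, leaving `1 /
  -- |z| ≤ 2`.
  have hρ : ρ ^ 2 ≤ 2 * C * ‖h‖ ^ 2 := by
    have hfac : (1 - δ)⁻¹ - (1 - δ) = (1 - (1 - δ) ^ 2) * (1 - δ)⁻¹ := by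
      field_simp
    have hinv2 : (1 - δ)⁻¹ ≤ 2 := by
      rw [inv_le_comm₀ hpos two_pos]; linarith
    refine le_of_mul_le_mul_left (hle.trans ?_) hsq
    rw [hfac]
    calc C * ((1 - (1 - δ) ^ 2) * (1 - δ)⁻¹) * ‖h‖ ^ 2
        ≤ C * ((1 - (1 - δ) ^ 2) * 2) * ‖h‖ ^ 2 := by gcongr
      _ = _ := by ring
  rw [Measure.real, E.scalarMeasure_apply _ Metric.isClosed_closedBall.measurableSet,
    ENNReal.toReal_ofReal (sq_nonneg _)]
  calc _ ≤ (2 * δ * ρ) ^ 2 := pow_le_pow_left₀ (norm_nonneg _) hproj 2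
    _ = 4 * δ ^ 2 * ρ ^ 2 := by ring
    _ ≤ 4 * δ ^ 2 * (2 * C * ‖h‖ ^ 2) := by gcongr
    _ = _ := by ring

end OrthogonalSpectralMeasure.IsSpectralMeasureOf

end Dilation

theorem mainTheorem6
    {H : Type*} [NormedAddCommGroup H] [InnerProductSpace ℂ H] [CompleteSpace H]
    {K : Type*} [NormedAddCommGroup K] [InnerProductSpace ℂ K] [CompleteSpace K]
    (V : H →ₗ.[ℂ] H) (hVclosed : V.IsClosed) (hViso : V.IsIsometric)
    (ι : H →ₗᵢ[ℂ] K) (U : unitary (K →L[ℂ] K)) (hU : IsUnitaryExtension V ι U)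
    (E : OrthogonalSpectralMeasure Circle K) (hE : E.IsSpectralMeasureOf U)
    (Δ : Set Circle) (hΔ : IsOpen Δ) (hΔne : Δ ≠ Set.univ) :
    spectralMeasure ι E Δ = 0 ↔
      HasAnalyticContinuation (generalizedResolvent ι U)
        (unitDisc ∪ exteriorDisc ∪ conjSet Δ) :=
  ⟨hE.hasAnalyticContinuation ι hΔ, hE.spectralMeasure_eq_zero ι hΔ⟩
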